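/- \textbf{Model.} Fix a set of processes and a directed network on it, in which every channel $(i,j)$ carries an upper bound $b_{ij}\ge 1$ on message transmission times (an integer, or $\infty$ if there is no finite bound). Time is global and discrete, $t=0,1,2,\dots$. The context $\gamma^{\mathsf{max}}$ consists of this network with its bounds, a set of possible initial configurations, and, for each process, a set of possible external inputs and a set of local actions. A protocol $P$ is deterministic. The local state of a process at time $0$ is determined by its initial data and its external inputs at time $0$, and its local state at time $t+1$ by the time, its local state at time $t$, and the external inputs and messages it receives at time $t+1$. The messages it sends to its neighbors and the local actions it performs at time $t$ are determined by $t$ and its local state at time $t$. The system $\mathcal R(P,\gamma^{\mathsf{max}})$ is the set of all runs in which the environment chooses freely a possible initial configuration, the external inputs (any set of inputs at each process-time node $(i,t)$, where the same external input event occurs at most once in a run), and the transmission times: each message sent at time $t$ over channel $(i,j)$ is received exactly once, at some time $t'$ with $t<t'\le t+b_{ij}$. \textbf{Syncausality.} For a run $r$, $\rightsquigarrow$ is the smallest relation on process-time nodes such that (1) $(i,t)\rightsquigarrow(i,t')$ whenever $t\le t'$; (2) $(i,t)\rightsquigarrow(j,t')$ whenever some message is sent at $(i,t)$ and received at $(j,t')$;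 (3) $(i,t)\rightsquigarrow(j,t+b_{ij})$ whenever $(i,j)$ is a channel with $b_{ij}<\infty$ and no message is sent over it at $(i,t)$; (4) $\rightsquigarrow$ is transitive. \textbf{Ordered Response.} Let $e_{\mathtt t}$ be an external input of process $i_0$ and let $\alpha_h$ be a local action of process $i_h$ for $h=1,\dots,k$. A protocol $P$ solves $\mathsf{OR}=\langle e_{\mathtt t},\alpha_1,\dots,\alpha_k\rangle$ if in every run $r\in\mathcal R(P,\gamma^{\mathsf{max}})$: each $\alpha_h$ occurs in $r$ if and only if $e_{\mathtt t}$ occurs in $r$; and whenever $\alpha_h$ occurs at time $s$ and $\alpha_{h'}$ at time $s'$ with $h<h'$, then $s\le s'$. \textbf{Theorem.} Let $P$ be a protocol solving $\mathsf{OR}=\langle e_{\mathtt t},\alpha_1,\dots,\alpha_k\rangle$. If $e_{\mathtt t}$ occurs at $(i_0,t)$ in a run $r\in\mathcal R(P,\gamma^{\mathsf{max}})$ and, for some $1\le h\le k$, $\alpha_h$ occurs at $(i_h,t_h)$ in $r$, then $(i_0,t)\rightsquigarrow(i_h,t_h)$ in $r$. -/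

import Mathlib

namespace SyncNet

universe uP uI uE uA uM uS

/-- A synchronous context with transmission bounds: a weighted directed network over the set
`Proc` of sites, the external inputs and local actions of each site, the messages, and the
possible initial configurations.  Time is global, discrete and common to all sites. -/
structure Context (Proc : Type uP) where
  /-- `chan i j`: there is a directed communication channel from `i` to `j`. -/
  chan : Proc → Proc → Prop
  /-- `bound i j` is the upper bound on transmission times on the channel from `i` to `j`;
  the value `⊤` stands for the absence of a finite bound.
  It is meaningful only if `chan i j` holds. -/
  bound : Proc → Proc → ℕ∞
  one_le_bound : ∀ i j, chan i j → 1 ≤ bound i j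
  /-- Initial local data of each site. -/
  Init : Proc → Type uI
  /-- The possible initial configurations. -/
  initial : Set ((i : Proc) → Init i)
  /-- The external inputs that each site may receive. -/
  Input : Proc → Type uE
  /-- The local actions of each site. -/
  Action : Proc → Type uA
  /-- Message contents. -/
  Msg : Type uM

variable {Proc : Type uP}

/-- A deterministic protocol.  All components may depend on the current global time,
since it is part of every local state.  A received message is presented to its recipient
as a triple (sender, sending time, content), so that distinct messages stay distinct. -/
structure Protocol (C : Context.{uP, uI, uE, uA, uM} Proc) where
  /-- Local states; a site need not remember its past. -/
  State : Proc → Type uS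
  /-- The local state at time `0`, from the initial data and the external inputs at time `0`. -/
  start : (i : Proc) → C.Init i → Set (C.Input i) → State i
  /-- `step i t ℓ I M` is the local state of `i` at time `t + 1`, where `ℓ` is its state at
  time `t`, and `I` and `M` are the external inputs and messages that it receives at `t + 1`. -/
  step : (i : Proc) → ℕ → State i → Set (C.Input i) → Set (Proc × ℕ × C.Msg) → State i
  /-- `send i t ℓ j` is the set of messages that `i` sends to its neighbor `j` at time `t` in
  local state `ℓ`; it is used only if there is a channel from `i` to `j`. -/
  send : (i : Proc) → ℕ → State i → Proc → Set C.Msg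
  /-- `act i t ℓ` is the set of local actions that `i` performs at time `t` in state `ℓ`. -/
  act : (i : Proc) → ℕ → State i → Set (C.Action i)

/-- A run of the protocol `P` in the context `C`.  The environment freely chooses the initial
configuration, the external inputs and the transmission times.  The only constraints are that
an external input event occurs at most once in a run, and that each message sent is delivered
exactly once, after at least one time unit and no later than the bound of its channel. -/
structure Run (C : Context.{uP, uI, uE, uA, uM} Proc)
    (P : Protocol.{uP, uI, uE, uA, uM, uS} C) where
  init : (i : Proc) → C.Init i
  init_mem : init ∈ C.initial
  /-- The local state of `i` at time `t`. -/
  state : (i : Proc) → ℕ → P.State i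
  /-- The external inputs that occur at `(i, t)`. -/
  input : (i : Proc) → ℕ → Set (C.Input i)
  /-- `(i, s, m) ∈ received j t`: at `(j, t)` the message `m` sent to `j` at `(i, s)`
  is received. -/
  received : Proc → ℕ → Set (Proc × ℕ × C.Msg)
  input_once : ∀ i (e : C.Input i) t t', e ∈ input i t → e ∈ input i t' → t = t'
  received_sent : ∀ j t i s m, (i, s, m) ∈ received j t →
    C.chan i j ∧ m ∈ P.send i s (state i s) j ∧ s < t ∧ (t : ℕ∞) ≤ (s : ℕ∞) + C.bound i j
  sent_received : ∀ i s j m, C.chan i j → m ∈ P.send i s (state i s) j →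
    ∃! t, (i, s, m) ∈ received j t
  state_zero : ∀ i, state i 0 = P.start i (init i) (input i 0)
  state_succ : ∀ i t,
    state i (t + 1) = P.step i t (state i t) (input i (t + 1)) (received i (t + 1))

section
variable {C : Context.{uP, uI, uE, uA, uM} Proc} {P : Protocol.{uP, uI, uE, uA, uM, uS} C}

/-- In the run `r`, the message `m` is sent at `(i, t)` to the neighbor `j` of `i`. -/
def Run.Sent (r : Run C P) (i : Proc) (t : ℕ) (j : Proc) (m : C.Msg) : Prop :=
  C.chan i j ∧ m ∈ P.send i t (r.state i t) j

/-- The external input `e` occurs at `(i, t)` in `r`. -/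
def Run.InputOccurs (r : Run C P) (i : Proc) (e : C.Input i) (t : ℕ) : Prop :=
  e ∈ r.input i t

/-- The local action `a` occurs (is performed) at `(i, t)` in `r`. -/
def Run.ActionOccurs (r : Run C P) (i : Proc) (a : C.Action i) (t : ℕ) : Prop :=
  a ∈ P.act i t (r.state i t)

/-- The syncausality relation over the nodes (site, time) of the run `r`. -/
inductive Run.Syncausal (r : Run C P) : Proc × ℕ → Proc × ℕ → Prop
  | loc (i : Proc) (t t' : ℕ) : t ≤ t' → Run.Syncausal r (i, t) (i, t')
  | message (i j : Proc) (t t' : ℕ) (m : C.Msg) :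
      r.Sent i t j m → (i, t, m) ∈ r.received j t' → Run.Syncausal r (i, t) (j, t')
  | timeout (i j : Proc) (t t' : ℕ) :
      C.chan i j → (∀ m, ¬ r.Sent i t j m) → (t' : ℕ∞) = (t : ℕ∞) + C.bound i j →
      Run.Syncausal r (i, t) (j, t')
  | trans (a b c : Proc × ℕ) :
      Run.Syncausal r a b → Run.Syncausal r b c → Run.Syncausal r a c

end

/-- An instance of the Ordered Response problem: a trigger, which is an external input of the
site `origin`, and responses `0, …, k - 1`, where the response `h` is a local action of
`site h`. -/
structure OrderedResponse (C : Context.{uP, uI, uE, uA, uM} Proc) where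
  origin : Proc
  trigger : C.Input origin
  k : ℕ
  site : Fin k → Proc
  response : (h : Fin k) → C.Action (site h)

/-- `P` solves the instance: in every run each response occurs if and only if the trigger
occurs, and responses occur in the prescribed order (simultaneity is allowed).
That no response precedes the trigger is not required explicitly. -/
def Solves {C : Context.{uP, uI, uE, uA, uM} Proc} (P : Protocol.{uP, uI, uE, uA, uM, uS} C)
    (R : OrderedResponse C) : Prop :=
  ∀ r : Run C P,
    (∀ h, (∃ s, r.ActionOccurs (R.site h) (R.response h) s) ↔
      ∃ t, r.InputOccurs R.origin R.trigger t) ∧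
    (∀ h h' s s', h < h' → r.ActionOccurs (R.site h) (R.response h) s →
      r.ActionOccurs (R.site h') (R.response h') s' → s ≤ s')

end SyncNet

namespace SyncNet

section
variable {Proc : Type*} {C : Context Proc} {P : Protocol C}

/-! If the response node lay outside the syncausal future of the trigger, the trigger could be
deleted without that node noticing: the response would occur in a run with no trigger. The work is
in choosing delivery times for the altered run so that nodes outside this future stay unchanged up
to a time `T`. Messages of `r` keep their delivery times; a message new to the altered run arrives
only at a node syncausally after its sender in `r`, or after `T` (`Run.exists_delivery_time`). So no
difference leaves the future of the trigger by time `T`. -/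

/-- The local states generated by the protocol when the environment chooses the initial
configuration `init`, the external inputs `input`, and the delivery time `δ i s j m` of a
message `m` sent from `i` to `j` at time `s`. -/
noncomputable def generatedState (P : Protocol C) (init : (i : Proc) → C.Init i)
    (input : (i : Proc) → ℕ → Set (C.Input i)) (δ : Proc → ℕ → Proc → C.Msg → ℕ) :
    ℕ → (i : Proc) → P.State i
  | 0 => fun i => P.start i (init i) (input i 0)
  | t + 1 => fun i =>
      P.step i t (generatedState P init input δ t i) (input i (t + 1))
        -- The guard makes the recursion well-founded; it loses nothing when deliveries come
        -- strictly after sending.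
        {x | ∃ _ : x.2.1 < t + 1, C.chan x.1 i ∧
          x.2.2 ∈ P.send x.1 x.2.1 (generatedState P init input δ x.2.1 x.1) i ∧
          δ x.1 x.2.1 i x.2.2 = t + 1}
termination_by t => t

/-- Every admissible choice of initial configuration, external inputs and delivery times
is realized by a run. -/
theorem exists_run (P : Protocol C) (init : (i : Proc) → C.Init i) (hinit : init ∈ C.initial)
    (input : (i : Proc) → ℕ → Set (C.Input i))
    (hinput : ∀ i (e : C.Input i) t t', e ∈ input i t → e ∈ input i t' → t = t')
    (δ : Proc → ℕ → Proc → C.Msg → ℕ)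
    (hδ : ∀ i s j m, C.chan i j →
      s < δ i s j m ∧ (δ i s j m : ℕ∞) ≤ (s : ℕ∞) + C.bound i j) :
    ∃ r : Run C P, r.init = init ∧ r.input = input ∧
      ∀ i s m j t, (i, s, m) ∈ r.received j t ↔ r.Sent i s j m ∧ δ i s j m = t := by
  refine ⟨{ init := init
            init_mem := hinit
            state := fun i t => generatedState P init input δ t i
            input := input
            received := fun j t => {x | (C.chan x.1 j ∧
              x.2.2 ∈ P.send x.1 x.2.1 (generatedState P init input δ x.2.1 x.1) j) ∧
              δ x.1 x.2.1 j x.2.2 = t}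
            input_once := hinput
            received_sent := ?_
            sent_received := ?_
            state_zero := ?_
            state_succ := ?_ }, rfl, rfl, fun _ _ _ _ _ => Iff.rfl⟩
  · rintro j t i s m ⟨⟨hc, hm⟩, rfl⟩
    exact ⟨hc, hm, hδ i s j m hc⟩
  · intro i s j m hc hm
    exact ⟨δ i s j m, ⟨⟨hc, hm⟩, rfl⟩, fun t ht => ht.2.symm⟩
  · intro i
    rw [generatedState]
  · intro i t
    rw [generatedState]
    refine congrArg (P.step i t _ _) ?_
    ext ⟨k, s, m⟩
    constructor
    · rintro ⟨-, hc, hm, hd⟩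
      exact ⟨⟨hc, hm⟩, hd⟩
    · rintro ⟨⟨hc, hm⟩, hd⟩
      exact ⟨hd ▸ (hδ k s i m hc).1, hc, hm, hd⟩

/-- A message sent over a channel at `(i, s)` has an admissible delivery time which is the
actual one if the message is sent in `r`, and which, if it is at most `T`, gives a node in the
syncausal future of `(i, s)`. -/
theorem Run.exists_delivery_time (r : Run C P) (T : ℕ) (i : Proc) (s : ℕ) (j : Proc)
    (m : C.Msg) (hc : C.chan i j) :
    ∃ d : ℕ, s < d ∧ (d : ℕ∞) ≤ (s : ℕ∞) + C.bound i j ∧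
      (r.Sent i s j m → (i, s, m) ∈ r.received j d) ∧
      (d ≤ T → r.Syncausal (i, s) (j, d)) := by
  have actual : ∀ m', r.Sent i s j m' → ∃ d : ℕ, s < d ∧
      (d : ℕ∞) ≤ (s : ℕ∞) + C.bound i j ∧ (i, s, m') ∈ r.received j d ∧
      r.Syncausal (i, s) (j, d) := by
    intro m' hm'
    obtain ⟨d, hd, -⟩ := r.sent_received i s j m' hc hm'.2
    obtain ⟨-, -, hlt, hle⟩ := r.received_sent j d i s m' hd
    exact ⟨d, hlt, hle, hd, .message i j s d m' hm' hd⟩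
  by_cases hm : r.Sent i s j m
  · obtain ⟨d, hlt, hle, hd, hsync⟩ := actual m hm
    exact ⟨d, hlt, hle, fun _ => hd, fun _ => hsync⟩
  -- A new message can travel with any message that `r` does send on the channel at that time.
  by_cases hex : ∃ m', r.Sent i s j m'
  · obtain ⟨m', hm'⟩ := hex
    obtain ⟨d, hlt, hle, -, hsync⟩ := actual m' hm'
    exact ⟨d, hlt, hle, fun h => absurd h hm, fun _ => hsync⟩
  push Not at hex
  have hone := C.one_le_bound i j hc
  cases hb : C.bound i j with
  | top =>
    -- With no finite bound, delivery is postponed beyond `T`.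
    exact ⟨max s T + 1, by omega, by simp, fun h => absurd h hm, fun h => by omega⟩
  | coe b =>
    rw [hb] at hone
    have hb1 : 1 ≤ b := by exact_mod_cast hone
    -- On a silent channel, delivery exactly at the bound matches the timeout clause.
    exact ⟨s + b, by omega, by simp, fun h => absurd h hm,
      fun _ => .timeout i j s (s + b) hc hex (by simp [hb])⟩

/-- Removing an external input event from a run does not affect, up to any given time, the
nodes outside its syncausal future. -/
theorem Run.exists_run_without_input (r : Run C P) (i₀ : Proc) (e : C.Input i₀) (t₀ : ℕ)
    (he : r.InputOccurs i₀ e t₀) (T : ℕ) :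
    ∃ r' : Run C P, (∀ t, ¬ r'.InputOccurs i₀ e t) ∧
      ∀ t ≤ T, ∀ i, ¬ r.Syncausal (i₀, t₀) (i, t) → r'.state i t = r.state i t := by
  have hex : ∀ i s j m, ∃ d : ℕ, C.chan i j → s < d ∧ (d : ℕ∞) ≤ (s : ℕ∞) + C.bound i j ∧
      (r.Sent i s j m → (i, s, m) ∈ r.received j d) ∧
      (d ≤ T → r.Syncausal (i, s) (j, d)) := by
    intro i s j m
    by_cases hc : C.chan i j
    · obtain ⟨d, hd⟩ := r.exists_delivery_time T i s j m hc
      exact ⟨d, fun _ => hd⟩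
    · exact ⟨0, fun h => absurd h hc⟩
  choose δ hδ using hex
  obtain ⟨r', hinit, hinput, hrec⟩ := exists_run P r.init r.init_mem
    -- Sigma pairs allow comparing inputs of different sites.
    (fun i t => {e' | e' ∈ r.input i t ∧ (⟨i, e'⟩ : Σ i, C.Input i) ≠ ⟨i₀, e⟩})
    (fun i e' t t' h h' => r.input_once i e' t t' h.1 h'.1) δ
    (fun i s j m hc => ⟨(hδ i s j m hc).1, (hδ i s j m hc).2.1⟩)
  have input_eq : ∀ i t, ¬ r.Syncausal (i₀, t₀) (i, t) → r'.input i t = r.input i t := by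
    intro i t hn
    rw [hinput]
    ext e'
    refine ⟨fun h => h.1, fun h => ⟨h, fun heq => hn ?_⟩⟩
    cases heq
    -- The deleted event occurs in `r` only at `t₀`, a node in its own future.
    rw [r.input_once _ _ _ _ h he]
    exact .loc _ _ _ le_rfl
  refine ⟨r', fun t h => ?_, fun t => ?_⟩
  · rw [Run.InputOccurs, hinput] at h
    exact h.2 rfl
  induction t using Nat.strong_induction_on with
  | _ t ih =>
    intro htT i hn
    cases t with
    | zero => rw [r'.state_zero, r.state_zero, input_eq i 0 hn, hinit]
    | succ t =>
      have state_eq : r'.state i t = r.state i t :=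
        ih t (by omega) (by omega) i fun h => hn (h.trans _ _ _ (.loc _ _ _ (by omega)))
      have received_eq : r'.received i (t + 1) = r.received i (t + 1) := by
        ext ⟨k, s, m⟩
        rw [hrec]
        constructor
        · rintro ⟨⟨hc, hm⟩, hd⟩
          obtain ⟨hlt, -, hsent, hsync⟩ := hδ k s i m hc
          rw [hd] at hlt hsent hsync
          -- Since the receipt is by time `T`, a sender inside the future would put the recipient
          -- there too.
          rw [ih s hlt (by omega) k fun h => hn (h.trans _ _ _ (hsync htT))] at hm
          exact hsent ⟨hc, hm⟩
        · intro h
          obtain ⟨hc, hm, hlt, -⟩ := r.received_sent _ _ _ _ _ h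
          have hk := ih s hlt (by omega) k fun h' =>
            hn (h'.trans _ _ _ (.message k i s (t + 1) m ⟨hc, hm⟩ h))
          -- A message of `r` has a unique receipt time, so `δ` gives that time.
          exact ⟨⟨hc, hk ▸ hm⟩, (r.sent_received k s i m hc hm).unique
            ((hδ k s i m hc).2.2.1 ⟨hc, hm⟩) h⟩
      rw [r'.state_succ, r.state_succ, state_eq, received_eq, input_eq i (t + 1) hn]

end

end SyncNet

theorem mainTheorem4 {Proc : Type*} (C : SyncNet.Context Proc) (P : SyncNet.Protocol C)
    (R : SyncNet.OrderedResponse C) (hP : SyncNet.Solves P R)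
    (r : SyncNet.Run C P) (t : ℕ) (ht : r.InputOccurs R.origin R.trigger t)
    (h : Fin R.k) (th : ℕ) (hth : r.ActionOccurs (R.site h) (R.response h) th) :
    r.Syncausal (R.origin, t) (R.site h, th) := by
  by_contra hn
  obtain ⟨r', hno, hstate⟩ := r.exists_run_without_input R.origin R.trigger t ht th
  have hact : r'.ActionOccurs (R.site h) (R.response h) th := by
    rw [SyncNet.Run.ActionOccurs, hstate th le_rfl _ hn]
    exact hth
  obtain ⟨t', ht'⟩ := ((hP r').1 h).1 ⟨th, hact⟩
  exact hno t' ht'
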